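/- Let $(X,\mathcal B,\mu)$ be an atomless standard Borel probability space. An automorphism of a probability space $(Z,\nu)$ is an invertible measure-preserving transformation, considered modulo $\nu$-null sets; we also write $T$ for the operator $f\mapsto f\circ T$ on $L_2(\nu)$. A Markov operator on $L_2(\nu)$ is a bounded operator $P$ such that $P$ and $P^*$ map non-negative functions to non-negative functions and constants to themselves. For $a\in(0,1]$ an automorphism $T$ of $(Z,\nu)$ is called $a$-rigid if there are natural numbers $j_k\to\infty$ and a Markov operator $P$ on $L_2(\nu)$ such that $T^{j_k}\to aI+(1-a)P$ in the weak operator topology. For an automorphism $S$ of $(X,\mu)$ let $\mathrm{Ext}(S)$ be the set of all automorphisms $R$ of $(X\times X,\mu\otimes\mu)$ of the form $R(x,y)=(Sx,R_xy)$, where $\{R_x\}_{x\in X}$ is a measurable family of automorphisms of $(X,\mu)$. Fix a sequence $(A_i)$ of measurable subsets of $X\times X$ that is dense in the measure algebra of $\mu\otimes\mu$, and equip $\mathrm{Ext}(S)$ with the topology induced by the Halmos metric $$\rho(R,R')=\sum_i2^{-i}\bigl((\mu\otimes\mu)(RA_i\,\Delta\,R'A_i)+(\mu\otimes\mu)(R^{-1}A_i\,\Delta\,R'^{-1}A_i)\bigr).$$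 **Theorem.** Let $a\in(0,1]$ and let $S$ be an ergodic $a$-rigid automorphism of $(X,\mu)$. Then the typical extension of $S$ is $a$-rigid: the set of $a$-rigid $R\in\mathrm{Ext}(S)$ contains a dense $G_\delta$ subset of $\mathrm{Ext}(S)$. -/

import Mathlib

open MeasureTheory Filter Topology Set
open scoped symmDiff

noncomputable section

/-- An automorphism of the measure space `(Z, ν)`: an invertible, bimeasurable, `ν`-preserving
transformation. Two automorphisms that agree almost everywhere are not identified as terms; they
are at distance `0` for the Halmos pseudometric below. On an atomless standard Borel probability
space every automorphism modulo null sets has a representative of this form. -/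
structure MPAut {Z : Type*} [MeasurableSpace Z] (ν : Measure Z) where
  toEquiv : Z ≃ᵐ Z
  preserving : MeasurePreserving toEquiv ν ν

namespace MPAut

instance {Z : Type*} [MeasurableSpace Z] (ν : Measure Z) :
    CoeFun (MPAut ν) (fun _ => Z → Z) where
  coe T := T.toEquiv

/-- The family `A` of measurable sets is dense in the measure algebra of `ν`. -/
def IsDenseFamily {Z : Type*} [MeasurableSpace Z] (ν : Measure Z) (A : ℕ → Set Z) : Prop :=
  (∀ i, MeasurableSet (A i)) ∧
    ∀ B : Set Z, MeasurableSet B → ∀ ε : ℝ, 0 < ε → ∃ i, ν.real (A i ∆ B) < ε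

/-- The Halmos distance
`ρ(S, T) = ∑ i, 2⁻ⁱ (ν(S Aᵢ ∆ T Aᵢ) + ν(S⁻¹ Aᵢ ∆ T⁻¹ Aᵢ))`. -/
def halmosDist {Z : Type*} [MeasurableSpace Z] (ν : Measure Z) (A : ℕ → Set Z)
    (S T : MPAut ν) : ℝ :=
  ∑' i : ℕ, (1 / 2 : ℝ) ^ i *
    (ν.real ((S '' A i) ∆ (T '' A i)) +
      ν.real ((S.toEquiv.symm '' A i) ∆ (T.toEquiv.symm '' A i)))

theorem summable_halmosDist {Z : Type*} [MeasurableSpace Z] (ν : Measure Z) [IsFiniteMeasure ν]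
    (A : ℕ → Set Z) (S T : MPAut ν) :
    Summable (fun i : ℕ => (1 / 2 : ℝ) ^ i *
      (ν.real ((S '' A i) ∆ (T '' A i)) +
        ν.real ((S.toEquiv.symm '' A i) ∆ (T.toEquiv.symm '' A i)))) := by
  refine Summable.of_nonneg_of_le (fun i => by positivity) (fun i => ?_)
    (summable_geometric_two.mul_right (ν.real univ + ν.real univ))
  refine mul_le_mul_of_nonneg_left ?_ (by positivity)
  exact add_le_add (measureReal_mono (subset_univ _)) (measureReal_mono (subset_univ _))

/-- The pseudometric space structure on automorphisms given by the Halmos distance. -/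
abbrev halmosPseudoMetric {Z : Type*} [MeasurableSpace Z] (ν : Measure Z) [IsFiniteMeasure ν]
    (A : ℕ → Set Z) : PseudoMetricSpace (MPAut ν) where
  dist := halmosDist ν A
  dist_self S := by simp [halmosDist]
  dist_comm S T := by simp only [halmosDist, symmDiff_comm]
  dist_triangle S T U := by
    have key : ∀ s t u : Set Z, ν.real (s ∆ u) ≤ ν.real (s ∆ t) + ν.real (t ∆ u) :=
      fun s t u => (measureReal_mono (symmDiff_triangle s t u)).trans (measureReal_union_le _ _)
    unfold halmosDist
    rw [← (summable_halmosDist ν A S T).tsum_add (summable_halmosDist ν A T U)]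
    refine (summable_halmosDist ν A S U).tsum_le_tsum (fun i => ?_)
      ((summable_halmosDist ν A S T).add (summable_halmosDist ν A T U))
    rw [← mul_add]
    refine mul_le_mul_of_nonneg_left ?_ (by positivity)
    linarith [key (S '' A i) (T '' A i) (U '' A i),
      key (S.toEquiv.symm '' A i) (T.toEquiv.symm '' A i) (U.toEquiv.symm '' A i)]

/-- The Koopman operator `f ↦ f ∘ T` on `L²(ν)`. -/
def koopman {Z : Type*} [MeasurableSpace Z] {ν : Measure Z} (T : MPAut ν) :
    Lp ℝ 2 ν →L[ℝ] Lp ℝ 2 ν :=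
  (Lp.compMeasurePreservingₗᵢ ℝ T T.preserving).toContinuousLinearMap

/-- Markov operators on `L²(ν)`: `P` and `P*` preserve non-negativity and fix the constants. -/
def IsMarkov {Z : Type*} [MeasurableSpace Z] (ν : Measure Z) [IsFiniteMeasure ν]
    (P : Lp ℝ 2 ν →L[ℝ] Lp ℝ 2 ν) : Prop :=
  (∀ f, 0 ≤ f → 0 ≤ P f) ∧
  (∀ f, 0 ≤ f → 0 ≤ ContinuousLinearMap.adjoint P f) ∧
  (∀ c : ℝ, P (Lp.const 2 ν c) = Lp.const 2 ν c) ∧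
  (∀ c : ℝ, ContinuousLinearMap.adjoint P (Lp.const 2 ν c) = Lp.const 2 ν c)

/-- `T` is `a`-rigid: along some `j k → ∞` the powers `T ^ (j k)` converge, in the weak operator
topology, to `a I + (1 - a) P` for some Markov operator `P`. -/
def IsARigid {Z : Type*} [MeasurableSpace Z] {ν : Measure Z} [IsFiniteMeasure ν]
    (a : ℝ) (T : MPAut ν) : Prop :=
  ∃ P : Lp ℝ 2 ν →L[ℝ] Lp ℝ 2 ν, IsMarkov ν P ∧
    ∃ j : ℕ → ℕ, Tendsto j atTop atTop ∧
      ∀ f g : Lp ℝ 2 ν,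
        Tendsto (fun k => inner ℝ ((T.koopman ^ j k) f) g) atTop
          (𝓝 (inner ℝ (a • f + (1 - a) • P f) g))

/-- `Ext(S)`: the automorphisms of `(X × X, μ ⊗ μ)` that coincide almost everywhere with a skew
product `(x, y) ↦ (S x, R_x y)`, where `R_x` is a measurable family of automorphisms of
`(X, μ)`. -/
def Ext {X : Type*} [MeasurableSpace X] {μ : Measure X} (S : MPAut μ) :
    Set (MPAut (μ.prod μ)) :=
  {R | ∃ r : X → MPAut μ, Measurable (fun p : X × X => r p.1 p.2) ∧
    ∀ᵐ p ∂(μ.prod μ), R p = (S p.1, r p.1 p.2)}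

/-- The property `Q` is typical in `E`: some dense Gδ subset of `E`, for the topology that the
Halmos distance induces on `E`, consists of automorphisms with the property `Q`. -/
def IsTypicalIn {Z : Type*} [MeasurableSpace Z] {ν : Measure Z} [IsFiniteMeasure ν]
    (A : ℕ → Set Z) (E : Set (MPAut ν)) (Q : MPAut ν → Prop) : Prop :=
  letI : PseudoMetricSpace (MPAut ν) := halmosPseudoMetric ν A
  ∃ G : Set E, IsGδ G ∧ Dense G ∧ ∀ R ∈ G, Q R

end MPAut

end

/-! By weak operator compactness, `a`-rigidity amounts to a lower bound on sets: along some j_k → ∞,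
liminf ν(T^{-j_k}C ∩ D) ≥ a ν(C ∩ D) for all measurable C, D (`RigidAlong`). The point is that any
weak limit Q of the powers then makes Q - aI positive (`RigidAlong.isARigid`,
`IsARigid.exists_rigidAlong`).

Fix a sequence `j` for S. For the countable dense family of sets, the strict lower bounds are open
conditions on R (`isOpen_setOf_lt_measureReal_iterate`), so meeting them at arbitrarily late times
of `j` is a Gδ condition.

Density is the substance (`exists_mem_Ext_rigidAlong`). Bounded convergence over the fibres shows
that S × Id is rigid along the same `j`, and so are its conjugates by maps (x, y) ↦ (x, k_x y).
These conjugates are the extensions by coboundaries k_{Sx} k_x⁻¹. Any cocycle agrees with a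
coboundary off a small set: let k_x be the product of the R's along the backward orbit of x up to
its first visit to a small set E. The two cocycles can differ only where Sx ∈ E, up to a null set.
-/

/-! ### Weak operator compactness. -/

theorem cauchySeq_of_denseRange {H : Type*} [PseudoMetricSpace H] {F : ℕ → H → ℝ} {C : ℝ}
    (hC : 0 ≤ C) (hF : ∀ k x y, |F k x - F k y| ≤ C * dist x y) {d : ℕ → H} (hd : DenseRange d)
    (h : ∀ m, CauchySeq fun k => F k (d m)) (x : H) : CauchySeq fun k => F k x := by
  refine Metric.cauchySeq_iff.2 fun ε hε => ?_
  obtain ⟨m, hm⟩ := hd.exists_dist_lt x (show 0 < ε / (3 * (C + 1)) by positivity)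
  obtain ⟨N, hN⟩ := Metric.cauchySeq_iff.1 (h m) (ε / 3) (by positivity)
  refine ⟨N, fun k hk l hl => ?_⟩
  have h1 := hN k hk l hl
  have h2 : C * dist x (d m) < ε / 3 := by
    rw [lt_div_iff₀ (by positivity)] at hm
    nlinarith [dist_nonneg (x := x) (y := d m)]
  have h3 := (abs_le.1 (hF k x (d m)))
  have h4 := (abs_le.1 (hF l x (d m)))
  rw [Real.dist_eq, abs_lt] at h1 ⊢
  constructor <;> linarith

/-- A sequence of contractions of a separable Hilbert space has a subsequence that converges in the
weak operator topology. -/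
theorem exists_subseq_tendsto_inner {H : Type*} [NormedAddCommGroup H] [InnerProductSpace ℝ H]
    [CompleteSpace H] [TopologicalSpace.SeparableSpace H] (U : ℕ → H →L[ℝ] H)
    (hU : ∀ k f, ‖U k f‖ ≤ ‖f‖) :
    ∃ φ : ℕ → ℕ, StrictMono φ ∧ ∃ Q : H →L[ℝ] H, ∀ f g,
      Tendsto (fun k => inner ℝ (U (φ k) f) g) atTop (𝓝 (inner ℝ (Q f) g)) := by
  have hb : ∀ k f g, |inner ℝ (U k f) g| ≤ ‖f‖ * ‖g‖ := fun k f g =>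
    (abs_real_inner_le_norm _ _).trans (mul_le_mul_of_nonneg_right (hU k f) (norm_nonneg _))
  let d := TopologicalSpace.denseSeq H
  have hd : DenseRange d := TopologicalSpace.denseRange_denseSeq H
  -- A countable product of compact intervals is sequentially compact, which replaces a diagonal
  -- argument over pairs of dense vectors.
  obtain ⟨L, -, φ, hφ, hL⟩ := (isCompact_univ_pi (X := fun _ : ℕ × ℕ => ℝ)
      fun p : ℕ × ℕ => isCompact_Icc (a := -(‖d p.1‖ * ‖d p.2‖))
        (b := ‖d p.1‖ * ‖d p.2‖)).tendsto_subseq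
    (x := fun k p => inner ℝ (U k (d p.1)) (d p.2)) (fun k p _ => abs_le.1 (hb k _ _))
  refine ⟨φ, hφ, ?_⟩
  have h1 : ∀ m g, CauchySeq fun k => inner ℝ (U (φ k) (d m)) g := fun m g =>
    cauchySeq_of_denseRange (F := fun k g => inner ℝ (U (φ k) (d m)) g) (C := ‖d m‖)
      (norm_nonneg _) (fun k x y => by
        rw [← inner_sub_right, dist_eq_norm]; exact hb _ _ _) hd
      (fun n => ((tendsto_pi_nhds.1 hL) (m, n)).cauchySeq) g
  have h2 : ∀ f g, CauchySeq fun k => inner ℝ (U (φ k) f) g := fun f g =>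
    cauchySeq_of_denseRange (F := fun k f => inner ℝ (U (φ k) f) g) (C := ‖g‖)
      (norm_nonneg _) (fun k x y => by
        rw [← inner_sub_left, ← map_sub, dist_eq_norm, mul_comm]; exact hb _ _ _) hd
      (fun n => h1 n g) f
  choose B hB using fun f g => cauchySeq_tendsto_of_complete (h2 f g)
  have e : ∀ {f g c}, Tendsto (fun k => inner ℝ (U (φ k) f) g) atTop (𝓝 c) → B f g = c :=
    fun h => tendsto_nhds_unique (hB _ _) h
  let B' : H →ₗ[ℝ] H →ₗ[ℝ] ℝ := LinearMap.mk₂ ℝ B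
    (fun f f' g => e (by simpa [inner_add_left] using (hB f g).add (hB f' g)))
    (fun c f g => e (by simpa [inner_smul_left] using (hB f g).const_mul c))
    (fun f g g' => e (by simpa [inner_add_right] using (hB f g).add (hB f g')))
    (fun c f g => e (by simpa [inner_smul_right] using (hB f g).const_mul c))
  have hB' : ∀ f g, ‖B' f g‖ ≤ 1 * ‖f‖ * ‖g‖ := fun f g => by
    rw [one_mul]
    exact le_of_tendsto (hB f g).norm (Eventually.of_forall fun k => hb _ _ _)
  refine ⟨InnerProductSpace.continuousLinearMapOfBilin (𝕜 := ℝ) (B'.mkContinuous₂ 1 hB'),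
    fun f g => ?_⟩
  rw [InnerProductSpace.continuousLinearMapOfBilin_apply]
  exact hB f g

/-! ### Positive operators on `L²`, tested on indicators. -/

section L2

variable {Z : Type*} [MeasurableSpace Z] {ν : Measure Z}

theorem L2_inner_nonneg {f g : Lp ℝ 2 ν} (hf : 0 ≤ f) (hg : 0 ≤ g) : 0 ≤ inner ℝ f g := by
  rw [L2.inner_def]
  rw [← Lp.coeFn_nonneg] at hf hg
  refine integral_nonneg_of_ae ?_
  filter_upwards [hf, hg] with x hx hx'
  exact mul_nonneg hx' hx

/-- The indicator function of a measurable set as an element of `L²`. -/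
noncomputable def indL2 (ν : Measure Z) [IsFiniteMeasure ν] {C : Set Z} (hC : MeasurableSet C) :
    Lp ℝ 2 ν :=
  indicatorConstLp 2 hC (measure_ne_top ν C) 1

variable [IsFiniteMeasure ν]

theorem inner_indL2 {C D : Set Z} (hC : MeasurableSet C) (hD : MeasurableSet D) :
    inner ℝ (indL2 ν hC) (indL2 ν hD) = ν.real (C ∩ D) := by
  rw [indL2, indL2, L2.inner_indicatorConstLp_one_indicatorConstLp_one]
  simp

theorem inner_indL2_eq_setIntegral (f : Lp ℝ 2 ν) {D : Set Z} (hD : MeasurableSet D) :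
    inner ℝ f (indL2 ν hD) = ∫ x in D, f x ∂ν := by
  rw [real_inner_comm]
  exact L2.inner_indicatorConstLp_one hD _ f

theorem indL2_nonneg {C : Set Z} (hC : MeasurableSet C) : 0 ≤ indL2 ν hC := by
  rw [← Lp.coeFn_nonneg]
  filter_upwards [indicatorConstLp_coeFn (p := 2) (hs := hC) (hμs := measure_ne_top ν C)
    (c := (1 : ℝ))] with x hx
  rw [indL2, hx]
  exact indicator_nonneg (fun _ _ => zero_le_one) x

theorem indL2_add_compl {C : Set Z} (hC : MeasurableSet C) :
    indL2 ν hC + indL2 ν hC.compl = Lp.const 2 ν (1 : ℝ) := by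
  rw [indL2, indL2, ← indicatorConstLp_univ,
    ← indicatorConstLp_disjoint_union hC hC.compl _ _ disjoint_compl_right]
  congr 1
  simp

theorem L2_nonneg_of_inner_indL2_nonneg {f : Lp ℝ 2 ν}
    (h : ∀ (D : Set Z) (hD : MeasurableSet D), 0 ≤ inner ℝ f (indL2 ν hD)) : 0 ≤ f := by
  rw [← Lp.coeFn_nonneg]
  refine ae_nonneg_of_forall_setIntegral_nonneg
    ((Lp.memLp f).integrable (by norm_num)) fun D hD _ => ?_
  rw [← inner_indL2_eq_setIntegral f hD]
  exact h D hD

/-- An operator on `L²` is positive as soon as its matrix coefficients on indicators are. -/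
theorem map_nonneg_of_inner_indL2_nonneg {W : Lp ℝ 2 ν →L[ℝ] Lp ℝ 2 ν}
    (h : ∀ (C : Set Z) (hC : MeasurableSet C) (D : Set Z) (hD : MeasurableSet D),
      0 ≤ inner ℝ (W (indL2 ν hC)) (indL2 ν hD)) {f : Lp ℝ 2 ν} (hf : 0 ≤ f) : 0 ≤ W f := by
  refine L2_nonneg_of_inner_indL2_nonneg fun D hD => ?_
  -- With the operator moved onto the indicator, only positivity of W* 1_D is left, and this is
  -- again tested on indicators.
  rw [← ContinuousLinearMap.adjoint_inner_right]
  refine L2_inner_nonneg hf (L2_nonneg_of_inner_indL2_nonneg fun C hC => ?_)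
  rw [ContinuousLinearMap.adjoint_inner_left, real_inner_comm]
  exact h C hC D hD

theorem eq_zero_of_inner_indL2_eq_zero {W : Lp ℝ 2 ν →L[ℝ] Lp ℝ 2 ν}
    (h : ∀ (C : Set Z) (hC : MeasurableSet C) (D : Set Z) (hD : MeasurableSet D),
      inner ℝ (W (indL2 ν hC)) (indL2 ν hD) = 0) : W = 0 := by
  have key : ∀ f : Lp ℝ 2 ν, (∀ (D : Set Z) (hD : MeasurableSet D),
      inner ℝ f (indL2 ν hD) = 0) → f = 0 := fun f hf =>
    le_antisymm (neg_nonneg.1 (L2_nonneg_of_inner_indL2_nonneg fun D hD => by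
      rw [inner_neg_left, hf D hD, neg_zero]))
      (L2_nonneg_of_inner_indL2_nonneg fun D hD => (hf D hD).ge)
  ext1 f
  refine key _ fun D hD => ?_
  have : ContinuousLinearMap.adjoint W (indL2 ν hD) = 0 := key _ fun C hC => by
    rw [ContinuousLinearMap.adjoint_inner_left, real_inner_comm]
    exact h C hC D hD
  rw [← ContinuousLinearMap.adjoint_inner_right, this, inner_zero_right]

/-- Doubly stochastic operators that dominate `a I` are of the form `a I + (1 - a) P` with `P`
Markov. -/
theorem exists_isMarkov_of_inner_indL2_ge {Q : Lp ℝ 2 ν →L[ℝ] Lp ℝ 2 ν} {a : ℝ} (ha : a ≤ 1)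
    (hpos : ∀ (C : Set Z) (hC : MeasurableSet C) (D : Set Z) (hD : MeasurableSet D),
      a * ν.real (C ∩ D) ≤ inner ℝ (Q (indL2 ν hC)) (indL2 ν hD))
    (h1 : ∀ c : ℝ, Q (Lp.const 2 ν c) = Lp.const 2 ν c)
    (h2 : ∀ c : ℝ, ContinuousLinearMap.adjoint Q (Lp.const 2 ν c) = Lp.const 2 ν c) :
    ∃ P, MPAut.IsMarkov ν P ∧ ∀ f, Q f = a • f + (1 - a) • P f := by
  set W := Q - a • ContinuousLinearMap.id ℝ (Lp ℝ 2 ν) with hW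
  have hWf : ∀ f, W f = Q f - a • f := fun f => by simp [hW]
  have hWadj : ∀ f, ContinuousLinearMap.adjoint W f
      = ContinuousLinearMap.adjoint Q f - a • f := fun f => by
    refine ext_inner_right ℝ fun g => ?_
    rw [ContinuousLinearMap.adjoint_inner_left, hWf, inner_sub_right, inner_sub_left,
      ContinuousLinearMap.adjoint_inner_left, inner_smul_right, real_inner_smul_left]
  have hWpos : ∀ (C : Set Z) (hC : MeasurableSet C) (D : Set Z) (hD : MeasurableSet D),
      0 ≤ inner ℝ (W (indL2 ν hC)) (indL2 ν hD) := fun C hC D hD => by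
    rw [hWf, inner_sub_left, real_inner_smul_left, inner_indL2]
    exact sub_nonneg.2 (hpos C hC D hD)
  rcases ha.lt_or_eq with ha | rfl
  · have ha' : 1 - a ≠ 0 := by linarith
    have hinv : 0 ≤ (1 - a)⁻¹ := inv_nonneg.2 (by linarith)
    have hadj : ∀ f, ContinuousLinearMap.adjoint ((1 - a)⁻¹ • W) f
        = (1 - a)⁻¹ • ContinuousLinearMap.adjoint W f := fun f => by simp
    refine ⟨(1 - a)⁻¹ • W, ⟨fun f hf => ?_, fun f hf => ?_, fun c => ?_, fun c => ?_⟩,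
      fun f => ?_⟩
    · refine map_nonneg_of_inner_indL2_nonneg (fun C hC D hD => ?_) hf
      rw [smul_apply, real_inner_smul_left]
      exact mul_nonneg hinv (hWpos C hC D hD)
    · refine map_nonneg_of_inner_indL2_nonneg (fun C hC D hD => ?_) hf
      rw [hadj, real_inner_smul_left, ContinuousLinearMap.adjoint_inner_left, real_inner_comm]
      exact mul_nonneg hinv (hWpos D hD C hC)
    · rw [smul_apply, hWf, h1, inv_smul_eq_iff₀ ha', sub_smul, one_smul]
    · rw [hadj, hWadj, h2, inv_smul_eq_iff₀ ha', sub_smul, one_smul]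
    · rw [smul_apply, smul_inv_smul₀ ha', hWf]
      abel
  · have hid : ContinuousLinearMap.adjoint (ContinuousLinearMap.id ℝ (Lp ℝ 2 ν)) =
        ContinuousLinearMap.id ℝ (Lp ℝ 2 ν) :=
      ((ContinuousLinearMap.eq_adjoint_iff _ _).2 fun f g => rfl).symm
    -- For a = 1 there is no division by 1 - a. Here W is positive and kills constants, so the
    -- nonnegative coefficients of C and of its complement sum to 0.
    have hW0 : W = 0 := eq_zero_of_inner_indL2_eq_zero fun C hC D hD => by
      have h := congrArg (fun f => inner ℝ (W f) (indL2 ν hD)) (indL2_add_compl (ν := ν) hC)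
      simp only [map_add, inner_add_left] at h
      rw [hWf (Lp.const 2 ν 1), h1, one_smul, sub_self, inner_zero_left] at h
      linarith [hWpos C hC D hD, hWpos _ hC.compl D hD]
    refine ⟨ContinuousLinearMap.id ℝ _, ⟨fun f hf => hf, fun f hf => ?_, fun c => rfl,
      fun c => ?_⟩, fun f => ?_⟩
    · rwa [hid]
    · rw [hid]; rfl
    · have := hWf f
      rw [hW0, one_smul, zero_apply] at this
      rw [sub_self, zero_smul, one_smul, add_zero]
      exact sub_eq_zero.1 this.symm

end L2

/-! ### Operator rigidity versus rigidity on sets. -/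

namespace MPAut

variable {Z : Type*} [MeasurableSpace Z] {ν : Measure Z}

theorem iterate_preserving (T : MPAut ν) (j : ℕ) : MeasurePreserving (T : Z → Z)^[j] ν ν :=
  T.preserving.iterate j

theorem norm_koopman_pow (T : MPAut ν) (j : ℕ) (f : Lp ℝ 2 ν) :
    ‖(T.koopman ^ j) f‖ = ‖f‖ := by
  induction j with
  | zero => simp
  | succ j ih =>
    rw [pow_succ', mul_apply_eq_comp, ← ih]
    exact (Lp.compMeasurePreservingₗᵢ ℝ T T.preserving).norm_map _

theorem inner_koopman_pow (T : MPAut ν) (j : ℕ) (f g : Lp ℝ 2 ν) :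
    inner ℝ ((T.koopman ^ j) f) ((T.koopman ^ j) g) = inner ℝ f g := by
  simp only [real_inner_eq_norm_add_mul_self_sub_norm_mul_self_sub_norm_mul_self_div_two,
    ← map_add, norm_koopman_pow]

variable [IsFiniteMeasure ν]

theorem koopman_pow_const (T : MPAut ν) (j : ℕ) (c : ℝ) :
    (T.koopman ^ j) (Lp.const 2 ν c) = Lp.const 2 ν c := by
  induction j with
  | zero => simp
  | succ j ih =>
    rw [pow_succ, mul_apply_eq_comp]
    have : T.koopman (Lp.const 2 ν c) = Lp.const 2 ν c := by
      rw [← indicatorConstLp_univ]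
      exact (Lp.indicatorConstLp_compMeasurePreserving MeasurableSet.univ (measure_ne_top _ _) c
        T.preserving)
    rw [this, ih]

theorem koopman_pow_indL2 (T : MPAut ν) (j : ℕ) {C : Set Z} (hC : MeasurableSet C) :
    (T.koopman ^ j) (indL2 ν hC) = indL2 ν ((T.iterate_preserving j).measurable hC) := by
  induction j with
  | zero => simp
  | succ j ih =>
    rw [pow_succ', mul_apply_eq_comp, ih]
    exact (Lp.indicatorConstLp_compMeasurePreserving _ (measure_ne_top _ _) 1 T.preserving)

/-- Partial rigidity on measurable sets along a sequence. -/
def RigidAlong (T : MPAut ν) (a : ℝ) (j : ℕ → ℕ) : Prop :=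
  ∀ C D : Set Z, MeasurableSet C → MeasurableSet D → ∀ ε : ℝ, 0 < ε →
    ∀ᶠ k in atTop, a * ν.real (C ∩ D) - ε ≤ ν.real ((T : Z → Z)^[j k] ⁻¹' C ∩ D)

/-- The weak limit exists only along a subsequence of `j`. Its adjoint fixes constants because ⟨Uʲf,
c⟩ = ⟨Uʲf, Uʲc⟩ = ⟨f, c⟩ for the Koopman operator U. -/
theorem RigidAlong.isARigid [MeasurableSpace.CountablyGenerated Z] {T : MPAut ν} {a : ℝ}
    {j : ℕ → ℕ} (h : T.RigidAlong a j) (hj : Tendsto j atTop atTop) (ha : a ≤ 1) :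
    T.IsARigid a := by
  have : Fact ((2 : ENNReal) ≠ ⊤) := ⟨by norm_num⟩
  obtain ⟨φ, hφ, Q, hQ⟩ := exists_subseq_tendsto_inner (fun k => T.koopman ^ j k)
    fun k f => (T.norm_koopman_pow (j k) f).le
  obtain ⟨P, hP, hPQ⟩ := exists_isMarkov_of_inner_indL2_ge (Q := Q) ha
    (fun C hC D hD => by
      refine le_of_forall_pos_sub_le fun ε hε => ?_
      refine ge_of_tendsto (hQ _ _) ((hφ.tendsto_atTop.eventually (h C D hC hD ε hε)).mono
        fun k hk => ?_)
      rwa [koopman_pow_indL2, inner_indL2])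
    (fun c => ext_inner_right ℝ fun g => tendsto_nhds_unique (hQ _ g) (by
      simp only [koopman_pow_const]; exact tendsto_const_nhds))
    (fun c => ext_inner_left ℝ fun f => by
      rw [ContinuousLinearMap.adjoint_inner_right]
      refine tendsto_nhds_unique (hQ f _) (tendsto_const_nhds.congr fun k => ?_)
      rw [← T.inner_koopman_pow (j (φ k)) f, koopman_pow_const])
  exact ⟨P, hP, j ∘ φ, hj.comp hφ.tendsto_atTop, fun f g => by rw [← hPQ]; exact hQ f g⟩

theorem IsARigid.exists_rigidAlong {T : MPAut ν} {a : ℝ} (ha : a ≤ 1) (h : T.IsARigid a) :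
    ∃ j : ℕ → ℕ, Tendsto j atTop atTop ∧ T.RigidAlong a j := by
  obtain ⟨P, hP, j, hj, hlim⟩ := h
  refine ⟨j, hj, fun C D hC hD ε hε => ?_⟩
  have h1 := hlim (indL2 ν hC) (indL2 ν hD)
  rw [inner_add_left, real_inner_smul_left, real_inner_smul_left, inner_indL2] at h1
  have h2 : 0 ≤ (1 - a) * inner ℝ (P (indL2 ν hC)) (indL2 ν hD) :=
    mul_nonneg (by linarith) (L2_inner_nonneg (hP.1 _ (indL2_nonneg hC)) (indL2_nonneg hD))
  filter_upwards [h1.eventually (lt_mem_nhds (show a * ν.real (C ∩ D) - ε < _ by linarith))]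
    with k hk
  rw [koopman_pow_indL2, inner_indL2] at hk
  exact hk.le

end MPAut

noncomputable section

/-- A point all of whose neighbourhoods have positive measure is itself null, so outer regularity
gives it a small open neighbourhood. -/
theorem exists_measurableSet_pos_lt {X : Type*} [MeasurableSpace X] [StandardBorelSpace X]
    (μ : Measure X) [IsProbabilityMeasure μ] [NullSingletonClass μ] {δ : ENNReal} (hδ : 0 < δ) :
    ∃ E, MeasurableSet E ∧ 0 < μ E ∧ μ E < δ := by
  let := upgradeStandardBorel X
  obtain ⟨x, -, hx⟩ := exists_mem_forall_mem_nhdsWithin_pos_measure (μ := μ) (s := univ) (by simp)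
  obtain ⟨U, hxU, hU, hlt⟩ := Set.exists_isOpen_lt_of_lt {x} δ
    ((measure_singleton (μ := μ) x).trans_lt hδ)
  exact ⟨U, hU.measurableSet,
    hx U (mem_nhdsWithin_of_mem_nhds (hU.mem_nhds (hxU rfl))), hlt⟩

namespace MPAut

/-! ### Continuity in the Halmos metric. -/

section General

variable {Z : Type*} [MeasurableSpace Z] {ν : Measure Z}

theorem measure_image (T : MPAut ν) (B : Set Z) : ν (T '' B) = ν B := by
  rw [← T.preserving.measure_preimage_equiv, preimage_image_eq _ T.toEquiv.injective]

theorem measureReal_preimage_symmDiff (T : MPAut ν) (C D : Set Z) :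
    ν.real ((T ⁻¹' C) ∆ (T ⁻¹' D)) = ν.real (C ∆ D) := by
  rw [← preimage_symmDiff, measureReal_def, T.preserving.measure_preimage_equiv, measureReal_def]

/-- The identity automorphism. -/
def refl (ν : Measure Z) : MPAut ν := ⟨MeasurableEquiv.refl Z, MeasurePreserving.id ν⟩

/-- The composition `T ∘ U`. -/
def comp (T U : MPAut ν) : MPAut ν :=
  ⟨U.toEquiv.trans T.toEquiv, T.preserving.comp U.preserving⟩

/-- The inverse automorphism. -/
def inv (T : MPAut ν) : MPAut ν := ⟨T.toEquiv.symm, T.preserving.symm T.toEquiv⟩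

theorem RigidAlong.of_semiconj [IsFiniteMeasure ν] {T R J : MPAut ν} {a : ℝ} {j : ℕ → ℕ}
    (hT : T.RigidAlong a j) (hJ : Function.Semiconj J T R) : R.RigidAlong a j := by
  intro C D hC hD ε hε
  have hp : ∀ B : Set Z, ν.real (J ⁻¹' B) = ν.real B := fun B => by
    rw [measureReal_def, J.preserving.measure_preimage_equiv, measureReal_def]
  filter_upwards [hT _ _ (J.preserving.measurable hC) (J.preserving.measurable hD) ε hε] with k hk
  rw [← preimage_inter, hp, ← preimage_comp, (hJ.iterate_right (j k)).comp_eq, preimage_comp,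
    ← preimage_inter, hp] at hk
  exact hk

variable [IsFiniteMeasure ν] {A : ℕ → Set Z}

/-- Images differ inside `S '' B ∪ T '' B`, preimages inside `B`: at most 3 ν(B) per term, and the
weights sum to 2. -/
theorem halmosDist_le (S T : MPAut ν) {B : Set Z} (hB : ∀ z ∉ B, S z = T z) :
    halmosDist ν A S T ≤ 6 * ν.real B := by
  have himg : ∀ T : MPAut ν, ν.real (T '' B) = ν.real B := fun T => by
    rw [measureReal_def, T.measure_image, measureReal_def]
  have h1 : ∀ C, ν.real ((S '' C) ∆ (T '' C)) ≤ 2 * ν.real B := fun C => by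
    have : (S '' C) ∆ (T '' C) ⊆ S '' B ∪ T '' B := by
      rintro _ (⟨⟨z, hz, rfl⟩, hn⟩ | ⟨⟨z, hz, rfl⟩, hn⟩)
      · exact Or.inl (mem_image_of_mem _ (by_contra fun h => hn (hB z h ▸ mem_image_of_mem _ hz)))
      · exact Or.inr (mem_image_of_mem _
          (by_contra fun h => hn ((hB z h).symm ▸ mem_image_of_mem _ hz)))
    refine (measureReal_mono this).trans ((measureReal_union_le _ _).trans ?_)
    rw [himg, himg, two_mul]
  have h2 : ∀ C, ν.real ((S.toEquiv.symm '' C) ∆ (T.toEquiv.symm '' C)) ≤ ν.real B := fun C => by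
    rw [MeasurableEquiv.image_symm, MeasurableEquiv.image_symm]
    refine measureReal_mono fun z hz => by_contra fun h => ?_
    simp [mem_symmDiff, hB z h] at hz
  calc halmosDist ν A S T ≤ ∑' i : ℕ, (1 / 2 : ℝ) ^ i * (3 * ν.real B) := by
        refine (summable_halmosDist ν A S T).tsum_le_tsum (fun i => ?_)
          (summable_geometric_two.mul_right _)
        refine mul_le_mul_of_nonneg_left ?_ (by positivity)
        linarith [h1 (A i), h2 (A i)]
    _ = 6 * ν.real B := by rw [tsum_mul_right, tsum_geometric_two]; ring

theorem measureReal_symmDiff_preimage_le (S T : MPAut ν) (i : ℕ) :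
    ν.real ((S ⁻¹' A i) ∆ (T ⁻¹' A i)) ≤ 2 ^ i * halmosDist ν A S T := by
  have h := (summable_halmosDist ν A S T).le_tsum i (fun _ _ => by positivity)
  rw [MeasurableEquiv.image_symm, MeasurableEquiv.image_symm] at h
  calc ν.real ((S ⁻¹' A i) ∆ (T ⁻¹' A i))
      = 2 ^ i * ((1 / 2 : ℝ) ^ i * ν.real ((S ⁻¹' A i) ∆ (T ⁻¹' A i))) := by
        rw [← mul_assoc, ← mul_pow]; norm_num
    _ ≤ 2 ^ i * halmosDist ν A S T := by
        refine mul_le_mul_of_nonneg_left (le_trans ?_ h) (by positivity)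
        refine mul_le_mul_of_nonneg_left ?_ (by positivity)
        exact le_add_of_nonneg_left measureReal_nonneg

theorem measureReal_symmDiff_triangle (s t u : Set Z) :
    ν.real (s ∆ u) ≤ ν.real (s ∆ t) + ν.real (t ∆ u) :=
  (measureReal_mono (symmDiff_triangle s t u)).trans (measureReal_union_le _ _)

theorem exists_halmosDist_lt_preimage (hA : IsDenseFamily ν A) (T : MPAut ν) {E : Set Z}
    (hE : MeasurableSet E) {ε : ℝ} (hε : 0 < ε) :
    ∃ δ > 0, ∀ S : MPAut ν, halmosDist ν A S T < δ →
      ν.real ((S ⁻¹' E) ∆ (T ⁻¹' E)) < ε := by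
  obtain ⟨i, hi⟩ := hA.2 E hE (ε / 3) (by positivity)
  refine ⟨ε / 3 / 2 ^ i, by positivity, fun S hS => ?_⟩
  rw [lt_div_iff₀ (by positivity), mul_comm] at hS
  have h1 := measureReal_symmDiff_triangle (ν := ν) (S ⁻¹' E) (S ⁻¹' A i) (T ⁻¹' E)
  have h2 := measureReal_symmDiff_triangle (ν := ν) (S ⁻¹' A i) (T ⁻¹' A i) (T ⁻¹' E)
  rw [measureReal_preimage_symmDiff, symmDiff_comm E] at h1
  rw [measureReal_preimage_symmDiff] at h2
  linarith [measureReal_symmDiff_preimage_le (A := A) S T i]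

theorem exists_halmosDist_lt_iterate (hA : IsDenseFamily ν A) (T : MPAut ν) {E : Set Z}
    (hE : MeasurableSet E) (j : ℕ) {ε : ℝ} (hε : 0 < ε) :
    ∃ δ > 0, ∀ S : MPAut ν, halmosDist ν A S T < δ →
      ν.real (((S : Z → Z)^[j] ⁻¹' E) ∆ ((T : Z → Z)^[j] ⁻¹' E)) < ε := by
  induction j generalizing ε with
  | zero => exact ⟨1, one_pos, fun S _ => by simpa using hε⟩
  | succ j ih =>
    obtain ⟨δ₁, hδ₁, h₁⟩ := ih (half_pos hε)
    -- The set T^{-j}E does not depend on `S`, so `δ₂` can be chosen beforehand.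
    obtain ⟨δ₂, hδ₂, h₂⟩ := exists_halmosDist_lt_preimage hA T
      ((T.iterate_preserving j).measurable hE) (half_pos hε)
    refine ⟨min δ₁ δ₂, lt_min hδ₁ hδ₂, fun S hS => ?_⟩
    have h := measureReal_symmDiff_triangle (ν := ν) (S ⁻¹' ((S : Z → Z)^[j] ⁻¹' E))
      (S ⁻¹' ((T : Z → Z)^[j] ⁻¹' E)) (T ⁻¹' ((T : Z → Z)^[j] ⁻¹' E))
    rw [measureReal_preimage_symmDiff] at h
    rw [Function.iterate_succ, Function.iterate_succ, preimage_comp, preimage_comp]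
    linarith [h₁ S (hS.trans_le (min_le_left _ _)), h₂ S (hS.trans_le (min_le_right _ _))]

theorem isOpen_setOf_lt_measureReal_iterate (hA : IsDenseFamily ν A) {C D : Set Z}
    (hC : MeasurableSet C) (hD : MeasurableSet D) (j : ℕ) (c : ℝ) :
    letI : PseudoMetricSpace (MPAut ν) := halmosPseudoMetric ν A
    IsOpen {T : MPAut ν | c < ν.real ((T : Z → Z)^[j] ⁻¹' C ∩ D)} := by
  let : PseudoMetricSpace (MPAut ν) := halmosPseudoMetric ν A
  refine Metric.isOpen_iff.2 fun T hT => ?_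
  obtain ⟨δ, hδ, h⟩ := exists_halmosDist_lt_iterate hA T hC j (sub_pos.2 hT)
  refine ⟨δ, hδ, fun S hS => ?_⟩
  have h1 := h S hS
  have hm : ∀ T : MPAut ν, MeasurableSet ((T : Z → Z)^[j] ⁻¹' C ∩ D) := fun T =>
    ((T.iterate_preserving j).measurable hC).inter hD
  have h2 := abs_le.1 (abs_measureReal_sub_le_measureReal_symmDiff (μ := ν)
    (hm S).nullMeasurableSet (hm T).nullMeasurableSet)
  rw [← inter_symmDiff_distrib_right] at h2
  have h3 := measureReal_mono (μ := ν) (inter_subset_left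
    (s := ((S : Z → Z)^[j] ⁻¹' C) ∆ ((T : Z → Z)^[j] ⁻¹' C)) (t := D))
  change c < ν.real ((S : Z → Z)^[j] ⁻¹' C ∩ D)
  linarith [h2.1]

theorem rigidAlong_of_isDenseFamily (hA : IsDenseFamily ν A) {T : MPAut ν} {a : ℝ} (ha : 0 < a)
    {j : ℕ → ℕ} (h : ∀ m n, ∀ ε : ℝ, 0 < ε → ∀ᶠ k in atTop,
      a * ν.real (A m ∩ A n) - ε ≤ ν.real ((T : Z → Z)^[j k] ⁻¹' A m ∩ A n)) :
    T.RigidAlong a j := by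
  intro C D hC hD ε hε
  -- Replacing C, D by members of the family costs 2aη on the left and 2η on the right; the
  -- hypothesis costs one more η.
  have hη : 0 < ε / (3 + 2 * a) := by positivity
  set η := ε / (3 + 2 * a)
  have hηε : η * (3 + 2 * a) = ε := div_mul_cancel₀ _ (by positivity)
  obtain ⟨m, hm⟩ := hA.2 C hC η hη
  obtain ⟨n, hn⟩ := hA.2 D hD η hη
  have key : ∀ {P Q P' Q' : Set Z},
      ν.real (P ∩ Q) ≤ ν.real (P' ∩ Q') + (ν.real (P' ∆ P) + ν.real (Q' ∆ Q)) := by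
    intro P Q P' Q'
    refine (measureReal_mono (s₂ := (P' ∩ Q') ∪ (P' ∆ P ∪ Q' ∆ Q)) fun z hz => ?_).trans
      ((measureReal_union_le _ _).trans (by gcongr; exact measureReal_union_le _ _))
    simp only [mem_union, mem_inter_iff, mem_symmDiff] at hz ⊢
    tauto
  filter_upwards [h m n η hη] with k hk
  have h1 := key (P := C) (Q := D) (P' := A m) (Q' := A n)
  have h2 := key (P := (T : Z → Z)^[j k] ⁻¹' A m) (Q := A n)
    (P' := (T : Z → Z)^[j k] ⁻¹' C) (Q' := D)
  rw [← preimage_symmDiff, measureReal_def ν (_ ⁻¹' (C ∆ A m)),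
    (T.iterate_preserving (j k)).measure_preimage (hC.symmDiff (hA.1 m)).nullMeasurableSet,
    ← measureReal_def, symmDiff_comm C, symmDiff_comm D] at h2
  have h3 := mul_le_mul_of_nonneg_left h1 ha.le
  have h4 := mul_le_mul_of_nonneg_left hm.le ha.le
  have h5 := mul_le_mul_of_nonneg_left hn.le ha.le
  nlinarith

end General

/-! ### Skew products and approximation by coboundaries. -/

section Skew

variable {X : Type*} [MeasurableSpace X] {μ : Measure X}

/-- The hitting time of a set of positive measure under the inverse of an ergodic automorphism. -/
theorem exists_hittingTime [IsFiniteMeasure μ] (S : MPAut μ) (hS : Ergodic S μ) {E : Set X}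
    (hE : MeasurableSet E) (hpos : 0 < μ E) :
    ∃ i : X → ℕ, Measurable i ∧ μ {x | i (S x) ≠ i x + 1} ≤ μ E := by
  classical
  set σ : X → X := fun x => S.toEquiv.symm x with hσ
  have hσm : Measurable σ := S.toEquiv.symm.measurable
  have hσS : ∀ n x, σ^[n + 1] (S x) = σ^[n] x := fun n x => by
    rw [Function.iterate_succ_apply]
    exact congrArg _ (S.toEquiv.symm_apply_apply x)
  set U : Set X := ⋃ n, σ^[n] ⁻¹' E with hUdef
  have hUm : MeasurableSet U := MeasurableSet.iUnion fun n => hσm.iterate n hE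
  have hUS : ∀ x ∈ U, S x ∈ U := fun x hx => by
    obtain ⟨n, hn⟩ := mem_iUnion.1 hx
    exact mem_iUnion.2 ⟨n + 1, by rw [mem_preimage, hσS]; exact hn⟩
  have hUnull : μ Uᶜ = 0 := by
    rcases hS.ae_empty_or_univ_of_ae_le_preimage hUm.nullMeasurableSet
      (Eventually.of_forall hUS) with h | h
    · refine absurd (measure_mono_null (t := U) (fun x hx => mem_iUnion.2 ⟨0, hx⟩) ?_) hpos.ne'
      rw [measure_congr h, measure_empty]
    · exact ae_eq_univ.1 h
  -- The alternative `x ∉ U` makes the hitting time total, with value 0 on the null set where the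
  -- backward orbit misses `E`.
  have hp : ∀ x, ∃ n, σ^[n] x ∈ E ∨ x ∉ U := fun x => by
    by_cases hx : x ∈ U
    · obtain ⟨n, hn⟩ := mem_iUnion.1 hx
      exact ⟨n, Or.inl hn⟩
    · exact ⟨0, Or.inr hx⟩
  refine ⟨fun x => Nat.find (hp x), measurable_find hp fun k =>
    (hσm.iterate k hE).union hUm.compl, ?_⟩
  have hsub : {x | Nat.find (hp (S x)) ≠ Nat.find (hp x) + 1} ⊆ S ⁻¹' E ∪ Uᶜ := by
    intro x hx
    by_contra hn
    simp only [mem_union, mem_preimage, mem_compl_iff, not_or, not_not] at hn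
    refine hx ((Nat.find_eq_iff _).2 ⟨?_, fun n hlt => ?_⟩)
    · rw [hσS]
      exact Or.inl ((Nat.find_spec (hp x)).resolve_right (not_not.2 hn.2))
    · rw [not_or, not_not]
      refine ⟨?_, hUS x hn.2⟩
      cases n with
      | zero => exact hn.1
      | succ n =>
        rw [hσS]
        exact fun h => Nat.find_min (hp x) (Nat.succ_lt_succ_iff.1 hlt) (Or.inl h)
  calc _ ≤ μ (S ⁻¹' E ∪ Uᶜ) := measure_mono hsub
    _ ≤ μ (S ⁻¹' E) + μ Uᶜ := measure_union_le _ _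
    _ = μ E := by rw [hUnull, add_zero, S.preserving.measure_preimage_equiv]

/-- `x ↦ R_{S⁻¹ x} ∘ R_{S⁻² x} ∘ ⋯ ∘ R_{S⁻ⁱ x}`. -/
def cocycle (S : MPAut μ) (r : X → MPAut μ) : ℕ → X → MPAut μ
  | 0, _ => refl μ
  | i + 1, x => comp (r (S.toEquiv.symm x)) (cocycle S r i (S.toEquiv.symm x))

theorem cocycle_succ (S : MPAut μ) (r : X → MPAut μ) (i : ℕ) (x y : X) :
    cocycle S r (i + 1) (S x) y = r x (cocycle S r i x y) := by
  change r (S.toEquiv.symm (S x)) (cocycle S r i (S.toEquiv.symm (S x)) y) = _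
  rw [S.toEquiv.symm_apply_apply]

theorem measurable_cocycle (S : MPAut μ) {r : X → MPAut μ}
    (hr : Measurable fun p : X × X => r p.1 p.2) (i : ℕ) :
    Measurable fun p : X × X => cocycle S r i p.1 p.2 := by
  induction i with
  | zero => exact measurable_snd
  | succ i ih =>
    have h1 : Measurable fun p : X × X => S.toEquiv.symm p.1 :=
      S.toEquiv.symm.measurable.comp measurable_fst
    exact hr.comp (h1.prodMk (ih.comp (h1.prodMk measurable_snd)))

variable [IsProbabilityMeasure μ]

theorem measureReal_prod_symm (C : Set (X × X)) (hC : MeasurableSet C) :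
    (μ.prod μ).real C = ∫ y, μ.real ((fun x => (x, y)) ⁻¹' C) ∂μ := by
  rw [measureReal_def, Measure.prod_apply_symm hC]
  exact (integral_toReal (measurable_measure_prodMk_right hC).aemeasurable
    (Eventually.of_forall fun y => measure_lt_top _ _)).symm

theorem integrable_measureReal_prodMk {C : Set (X × X)} (hC : MeasurableSet C) :
    Integrable (fun y => μ.real ((fun x => (x, y)) ⁻¹' C)) μ :=
  Integrable.of_bound (measurable_measure_prodMk_right hC).ennreal_toReal.aestronglyMeasurable 1
    (Eventually.of_forall fun y => by
      rw [Real.norm_of_nonneg measureReal_nonneg]; exact measureReal_le_one)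

variable [StandardBorelSpace X]

/-- The skew product `(x, y) ↦ (S x, R_x y)`. -/
def skew (S : MPAut μ) (r : X → MPAut μ) (hr : Measurable fun p : X × X => r p.1 p.2) :
    MPAut (μ.prod μ) where
  toEquiv :=
    let e : X × X ≃ X × X :=
      { toFun := fun p => (S p.1, r p.1 p.2)
        invFun := fun p => (S.toEquiv.symm p.1,
          (r (S.toEquiv.symm p.1)).toEquiv.symm p.2)
        left_inv := fun p => by simp
        right_inv := fun p => by simp }
    have he : Measurable e := (S.toEquiv.measurable.comp measurable_fst).prodMk hr
    { e with
      measurable_toFun := he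
      -- By Lusin–Souslin, an injective measurable map of standard Borel spaces has measurable
      -- images; no measurability of x ↦ R_x⁻¹ is assumed.
      measurable_invFun := fun s hs => by
        rw [← Equiv.invFun_as_coe]
        exact (congrArg MeasurableSet (e.image_eq_preimage_symm s)).mp
          ((he.measurableEmbedding e.injective).measurableSet_image.2 hs) }
  preserving := S.preserving.skew_product (g := fun x y => r x y) hr
    (Eventually.of_forall fun x => (r x).preserving.map_eq)

theorem skew_apply (S : MPAut μ) (r : X → MPAut μ) (hr : Measurable fun p : X × X => r p.1 p.2)
    (p : X × X) : skew S r hr p = (S p.1, r p.1 p.2) := rfl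

theorem measurable_inv_family {r : X → MPAut μ} (hr : Measurable fun p : X × X => r p.1 p.2) :
    Measurable fun p : X × X => (r p.1).inv p.2 :=
  measurable_snd.comp (skew (refl μ) r hr).toEquiv.symm.measurable

/-- Partial rigidity of `S` passes to `S × Id`. -/
theorem RigidAlong.skew_refl {S : MPAut μ} {a : ℝ} (ha : 0 < a) {j : ℕ → ℕ}
    (h : S.RigidAlong a j) : (skew S (fun _ => refl μ) measurable_snd).RigidAlong a j := by
  intro C D hC hD ε hε
  set T := skew S (fun _ => refl μ) measurable_snd with hT
  have hTit : ∀ (n : ℕ) (x y : X), (T : X × X → X × X)^[n] (x, y) = ((S : X → X)^[n] x, y) := by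
    intro n
    induction n with
    | zero => exact fun x y => rfl
    | succ n ih =>
      intro x y
      rw [Function.iterate_succ_apply, Function.iterate_succ_apply]
      exact ih _ _
  have hm : ∀ k, MeasurableSet ((T : X × X → X × X)^[j k] ⁻¹' C ∩ D) := fun k =>
    ((T.iterate_preserving (j k)).measurable hC).inter hD
  let u : X → ℝ := fun y => a * μ.real ((fun x => (x, y)) ⁻¹' (C ∩ D))
  let v : ℕ → X → ℝ := fun k y =>
    μ.real ((fun x => (x, y)) ⁻¹' ((T : X × X → X × X)^[j k] ⁻¹' C ∩ D))
  have hu : Integrable u μ := (integrable_measureReal_prodMk (hC.inter hD)).const_mul a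
  have hv : ∀ k, Integrable (v k) μ := fun k => integrable_measureReal_prodMk (hm k)
  -- Rigidity of S on each section bounds `v k y` only from below, so it is the positive part of the
  -- deficit that tends to 0; it is dominated by `u`.
  have hlim : Tendsto (fun k => ∫ y, max (u y - v k y) 0 ∂μ) atTop (𝓝 (∫ _, (0 : ℝ) ∂μ)) := by
    refine tendsto_integral_of_dominated_convergence u
      (fun k => ((hu.sub (hv k)).sup (integrable_zero _ _ _)).aestronglyMeasurable) hu
      (fun k => Eventually.of_forall fun y => ?_) (Eventually.of_forall fun y => ?_)
    · rw [Real.norm_of_nonneg (le_max_right _ _)]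
      exact max_le (sub_le_self _ measureReal_nonneg) (mul_nonneg ha.le measureReal_nonneg)
    · refine Metric.tendsto_atTop.2 fun η hη => ?_
      obtain ⟨N, hN⟩ := eventually_atTop.1 (h ((fun x => (x, y)) ⁻¹' C) ((fun x => (x, y)) ⁻¹' D)
        (measurable_prodMk_right hC) (measurable_prodMk_right hD) (η / 2) (half_pos hη))
      refine ⟨N, fun k hk => ?_⟩
      have h1 := hN k hk
      have h2 : v k y = μ.real ((S : X → X)^[j k] ⁻¹' ((fun x => (x, y)) ⁻¹' C) ∩
          (fun x => (x, y)) ⁻¹' D) := by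
        simp only [v, preimage_inter, ← preimage_comp]
        congr 2
        ext x
        simp [hTit]
      rw [← h2, ← preimage_inter] at h1
      rw [Real.dist_eq, sub_zero, abs_of_nonneg (le_max_right _ _)]
      refine max_lt ?_ hη
      change a * _ - v k y < η
      linarith
  rw [integral_zero] at hlim
  filter_upwards [hlim.eventually (gt_mem_nhds hε)] with k hk
  have h1 : ∫ y, (u y - v k y) ∂μ ≤ ∫ y, max (u y - v k y) 0 ∂μ :=
    integral_mono (hu.sub (hv k)) ((hu.sub (hv k)).sup (integrable_zero _ _ _))
      fun y => le_max_left _ _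
  rw [integral_sub hu (hv k), integral_const_mul, ← measureReal_prod_symm _ (hC.inter hD),
    ← measureReal_prod_symm _ (hm k)] at h1
  linarith

theorem exists_mem_Ext_rigidAlong [NullSingletonClass μ] {S : MPAut μ} (hS : Ergodic S μ) {a : ℝ}
    (ha : 0 < a) {j : ℕ → ℕ} (h : S.RigidAlong a j) (A : ℕ → Set (X × X)) {R : MPAut (μ.prod μ)}
    (hR : R ∈ S.Ext) {ε : ℝ} (hε : 0 < ε) :
    ∃ R' ∈ S.Ext, R'.RigidAlong a j ∧ halmosDist (μ.prod μ) A R R' < ε := by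
  obtain ⟨r, hr, hRr⟩ := hR
  obtain ⟨E, hE, hE0, hEε⟩ := exists_measurableSet_pos_lt μ
    (ENNReal.ofReal_pos.2 (show 0 < ε / 6 by positivity))
  obtain ⟨i, hi, hiE⟩ := exists_hittingTime S hS hE hE0
  let k : X → MPAut μ := fun x => cocycle S r (i x) x
  have hk : Measurable fun p : X × X => k p.1 p.2 := by
    have : Measurable fun q : ℕ × (X × X) => cocycle S r q.1 q.2.1 q.2.2 :=
      measurable_from_prod_countable_right fun n => measurable_cocycle S hr n
    exact this.comp ((hi.comp measurable_fst).prodMk measurable_id)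
  -- This coboundary makes (x, y) ↦ (x, k_x y) intertwine S × Id with the new extension. Where i(Sx)
  -- = i(x) + 1, one has k_{Sx} = r_x k_x, hence r'_x = r_x.
  let r' : X → MPAut μ := fun x => comp (k (S x)) (k x).inv
  have hr' : Measurable fun p : X × X => r' p.1 p.2 :=
    hk.comp ((S.toEquiv.measurable.comp measurable_fst).prodMk (measurable_inv_family hk))
  have hr'k : ∀ x y, r' x (k x y) = k (S x) y := fun x y => by
    change k (S x) ((k x).toEquiv.symm (k x y)) = _
    rw [(k x).toEquiv.symm_apply_apply]
  have hr'r : ∀ x, i (S x) = i x + 1 → ∀ y, r' x y = r x y := fun x hx y => by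
    have hy : k x ((k x).toEquiv.symm y) = y := (k x).toEquiv.apply_symm_apply y
    rw [← hy, hr'k]
    change cocycle S r (i (S x)) (S x) _ = _
    rw [hx, cocycle_succ]
  refine ⟨skew S r' hr', ⟨r', hr', Eventually.of_forall fun p => rfl⟩,
    (h.skew_refl ha).of_semiconj (J := skew (refl μ) k hk) fun p => ?_, ?_⟩
  · exact Prod.ext rfl (hr'k p.1 p.2).symm
  · let B : Set (X × X) := {p | R p ≠ (S p.1, r p.1 p.2)} ∪ {x | i (S x) ≠ i x + 1} ×ˢ univ
    have hB : μ.prod μ B < ENNReal.ofReal (ε / 6) := by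
      refine (measure_union_le _ _).trans_lt ?_
      rw [show μ.prod μ {p | R p ≠ (S p.1, r p.1 p.2)} = 0 from hRr, zero_add,
        Measure.prod_prod, measure_univ, mul_one]
      exact hiE.trans_lt hEε
    have hB' : (μ.prod μ).real B < ε / 6 :=
      (ENNReal.lt_ofReal_iff_toReal_lt (measure_ne_top _ _)).1 hB
    refine (halmosDist_le R (skew S r' hr') (B := B) fun p hp => ?_).trans_lt (by linarith)
    simp only [B, mem_union, mem_ofPred_eq, mem_prod, mem_univ, and_true, not_or, not_not] at hp
    rw [hp.1, skew_apply, hr'r p.1 hp.2]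

end Skew

end MPAut

end

/-! ### The dense Gδ set. -/

theorem mainTheorem8 {X : Type*} [MeasurableSpace X] [StandardBorelSpace X]
    (μ : Measure X) [IsProbabilityMeasure μ] [NullSingletonClass μ]
    (A : ℕ → Set (X × X)) (hA : MPAut.IsDenseFamily (μ.prod μ) A)
    (a : ℝ) (ha_pos : 0 < a) (ha_le : a ≤ 1)
    (S : MPAut μ) (hS : Ergodic S μ) (hrigid : S.IsARigid a) :
    MPAut.IsTypicalIn A S.Ext (fun R => R.IsARigid a) := by
  obtain ⟨j, hj, hSj⟩ := hrigid.exists_rigidAlong ha_le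
  let : PseudoMetricSpace (MPAut (μ.prod μ)) := MPAut.halmosPseudoMetric (μ.prod μ) A
  let V : ℕ → ℕ → Set (MPAut (μ.prod μ)) := fun N k => ⋂ m ∈ Iic N, ⋂ n ∈ Iic N,
    {R | a * (μ.prod μ).real (A m ∩ A n) - 1 / ((N : ℝ) + 1) <
      (μ.prod μ).real ((R : X × X → X × X)^[j k] ⁻¹' A m ∩ A n)}
  have hV : ∀ N k, IsOpen (V N k) := fun N k =>
    (finite_Iic N).isOpen_biInter fun m _ => (finite_Iic N).isOpen_biInter fun n _ =>
      MPAut.isOpen_setOf_lt_measureReal_iterate hA (hA.1 m) (hA.1 n) (j k) _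
  have hmem : ∀ {N k R}, R ∈ V N k ↔ ∀ m ≤ N, ∀ n ≤ N,
      a * (μ.prod μ).real (A m ∩ A n) - 1 / ((N : ℝ) + 1) <
        (μ.prod μ).real ((R : X × X → X × X)^[j k] ⁻¹' A m ∩ A n) := by
    intro N k R
    simp only [V, mem_iInter, mem_Iic, mem_ofPred_eq]
  refine ⟨Subtype.val ⁻¹' ⋂ N, ⋃ k ≥ N, V N k, ?_, ?_, ?_⟩
  · exact (IsGδ.iInter_of_isOpen fun N =>
      isOpen_biUnion fun k _ => hV N k).preimage continuous_subtype_val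
  · refine Metric.dense_iff.2 fun R ε hε => ?_
    obtain ⟨R', hR', hrig, hdist⟩ := MPAut.exists_mem_Ext_rigidAlong hS ha_pos hSj A R.2 hε
    refine ⟨⟨R', hR'⟩, Metric.mem_ball'.2 hdist, mem_iInter.2 fun N => ?_⟩
    -- Halving the tolerance turns the non-strict bound of `RigidAlong` into the strict one that
    -- defines `V N k`.
    have hev : ∀ᶠ k in atTop, R' ∈ V N k := by
      simp only [hmem]
      refine (eventually_all_finite (finite_Iic N)).2 fun m _ =>
        (eventually_all_finite (finite_Iic N)).2 fun n _ => ?_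
      have hN : (0 : ℝ) < 1 / (N + 1) := by positivity
      filter_upwards [hrig (A m) (A n) (hA.1 m) (hA.1 n) (1 / (N + 1) / 2) (half_pos hN)] with k hk
      linarith
    obtain ⟨k, hk, hkN⟩ := (hev.and (eventually_ge_atTop N)).exists
    exact mem_biUnion (show k ≥ N from hkN) hk
  · rintro ⟨R, hR⟩ hRG
    have h1 : ∀ N, ∃ k, N ≤ k ∧ R ∈ V N k := fun N => by
      simpa using mem_iInter.1 hRG N
    -- The witness `k N ≥ N` depends on R, so each R in the set is rigid along its own sequence `j ∘
    -- k`, which still tends to infinity.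
    choose k hk hkV using h1
    refine (MPAut.rigidAlong_of_isDenseFamily hA ha_pos (j := j ∘ k) fun m n ε hε => ?_).isARigid
      (hj.comp (tendsto_atTop_mono hk tendsto_id)) ha_le
    filter_upwards [eventually_ge_atTop (max m n),
      tendsto_one_div_add_atTop_nhds_zero_nat.eventually (gt_mem_nhds hε)] with N hN hNε
    have := hmem.1 (hkV N) m (le_of_max_le_left hN) n (le_of_max_le_right hN)
    simp only [Function.comp_apply]
    linarith
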